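/- Let $M_0>0$, let $0<\mu_1\le\mu_2\le\cdots$ be an increasing sequence of real numbers, and put $M_j:=M_0\mu_1\cdots\mu_j$ for $j\ge 0$. Let $b>0$ and let $j_0$ be the least integer $j\ge 0$ with $j\ge\log(M_0/b)$. Assume that $\sum_{j=j_0+1}^{\infty}\frac1{\mu_j}>e$ (the sum may be infinite), and let $$N:=1+\sup\Big\{n\in\mathbb{Z}_{\ge 0}:\ \sum_{j=j_0+1}^{n}\frac1{\mu_j}<e\Big\},$$ where empty sums are $0$; this is a finite positive integer that depends only on $(\mu_j)_j$ and $b/M_0$. Assume that $N\ge 2$. Let $\tilde\mu:[1,\infty)\to(0,\infty)$ be any increasing, continuous, piecewise $C^1$ function with $\tilde\mu(k)=\mu_k$ for all integers $k\ge1$, and set $$C_N:=4\exp\Big(4+\sup_{1\le s\le 2(N-1)}\frac{s\,\tilde\mu'(s)}{\tilde\mu(s)}\Big),$$ where $\tilde\mu'$ denotes the left derivative (at $s=1$ the right derivative). **Theorem.** Let $f:[0,1]\to\mathbb{R}$ be of class $C^{2(N-1)}$ in an open neighbourhood of $[0,1]$, with $\sup_{[0,1]}|f^{(j)}|\le M_j$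 for all $0\le j\le 2(N-1)$ and $\|f\|_{[0,1]}\ge b$, where $\|f\|_S:=\sup_{S}|f|$. Then for every interval $I\subseteq[0,1]$ and every Lebesgue measurable set $E\subseteq I$ with $|E|>0$, $$\|f\|_I\le\Big(\frac{C_N\,|I|}{|E|}\Big)^{2(N-1)}\|f\|_E .$$ Here $|\cdot|$ is Lebesgue measure. In particular $N$ and $C_N$ do not depend on $f$. -/

import Mathlib

noncomputable section

namespace ControlledDeriv

/-- A full admissible weight with all entries finite: a positive number `M₀` and a positive
(weakly) increasing sequence `μ 1 ≤ μ 2 ≤ …`. The value `μ 0` is never used. -/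
structure FullAdmissibleWeight where
  /-- the sequence of quotients, indexed by `j ≥ 1` -/
  μ : ℕ → ℝ
  /-- the initial value -/
  M₀ : ℝ
  M₀_pos : 0 < M₀
  μ_pos : ∀ j, 1 ≤ j → 0 < μ j
  μ_mono : ∀ j, 1 ≤ j → μ j ≤ μ (j + 1)

/-- The associated sequence `M j = M₀ * μ 1 * ⋯ * μ j`. -/
def FullAdmissibleWeight.M (W : FullAdmissibleWeight) (j : ℕ) : ℝ :=
  W.M₀ * ∏ i ∈ Finset.Icc 1 j, W.μ i

/-- The supremum norm of `f` on `S`; it is used for `f` bounded on a nonempty set `S`. -/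
def supNorm (f : ℝ → ℝ) (S : Set ℝ) : ℝ := sSup ((fun x => |f x|) '' S)

/-- `f` is smooth on `K` with respect to the weight `W` truncated at order `n`: it is of class `C^n`
in an open neighbourhood of the compact interval `K`, and the sup-norm over `K` of its `j`-th
derivative is at most `M j`, for all finite `j ≤ n`. -/
def IsWeightSmooth (W : FullAdmissibleWeight) (n : ℕ∞) (K : Set ℝ) (f : ℝ → ℝ) : Prop :=
  (∃ U : Set ℝ, IsOpen U ∧ K ⊆ U ∧ ContDiffOn ℝ n f U) ∧
    ∀ j : ℕ, (j : ℕ∞) ≤ n → supNorm (iteratedDeriv j f) K ≤ W.M j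

/-- The least natural number `j` with `j ≥ log b⁻¹`. -/
def j₀ (b : ℝ) : ℕ := ⌈Real.log b⁻¹⌉₊

/-- The degree of the sequence `μ` at `b`: the supremum in `ℕ ∪ {∞}` of all `n` such that
`1 / μ (j₀ b + 1) + ⋯ + 1 / μ n < e` (an empty sum is `0`). -/
def degree (μ : ℕ → ℝ) (b : ℝ) : ℕ∞ :=
  ⨆ n ∈ {n : ℕ | ∑ j ∈ Finset.Icc (j₀ b + 1) n, 1 / μ j < Real.exp 1}, (n : ℕ∞)

/-- Convex bodies of the line: compact convex sets with nonempty interior. -/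
def IsConvexBody (K : Set ℝ) : Prop := IsCompact K ∧ Convex ℝ K ∧ (interior K).Nonempty

/-- Admissible data: the series of the `1 / μ j` over `j ≥ j₀ + 1`, with `j₀ = j₀ (b / (2 * M₀))`,
has a (possibly infinite) sum greater than `e * diam K`. -/
def IsAdmissibleData (W : FullAdmissibleWeight) (K : Set ℝ) (b : ℝ) : Prop :=
  IsConvexBody K ∧ 0 < b ∧
    ENNReal.ofReal (Metric.diam K * Real.exp 1) <
      ∑' i : ℕ, ENNReal.ofReal (1 / W.μ (j₀ (b / (2 * W.M₀)) + 1 + i))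

/-- `N` is the integer associated with the data: one plus the degree of the sequence
`diam K * μ j` at `b / (2 * M₀)`. -/
def IsAssociatedInteger (W : FullAdmissibleWeight) (K : Set ℝ) (b : ℝ) (N : ℕ) : Prop :=
  (N : ℕ∞) = degree (fun j => Metric.diam K * W.μ j) (b / (2 * W.M₀)) + 1

/-- `g` is a positive, increasing, continuous, piecewise `C¹` function on `[1, ∞)` that takes the
value `μ k` at every integer `k ≥ 1`. -/
structure IsInterpolation (g : ℝ → ℝ) (μ : ℕ → ℝ) : Prop where
  pos : ∀ s, 1 ≤ s → 0 < g s
  mono : MonotoneOn g (Set.Ici 1)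
  cont : ContinuousOn g (Set.Ici 1)
  piecewise : ∃ p : ℕ → ℝ, StrictMono p ∧ p 0 = 1 ∧ Filter.Tendsto p Filter.atTop Filter.atTop ∧
    ∀ i, ContDiffOn ℝ 1 g (Set.Icc (p i) (p (i + 1)))
  interp : ∀ k : ℕ, 1 ≤ k → g k = μ k

/-- The left derivative of a function on `[1, ∞)` at `s > 1`; at the end point `1` the right
derivative. -/
def leftDeriv (g : ℝ → ℝ) (s : ℝ) : ℝ :=
  if 1 < s then derivWithin g (Set.Iic s) s else derivWithin g (Set.Ici s) s

/-- The supremum over `1 ≤ s ≤ n` of `s * g' s / g s`. -/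
def gam (g : ℝ → ℝ) (n : ℕ) : ℝ :=
  sSup ((fun s => s * leftDeriv g s / g s) '' Set.Icc (1 : ℝ) n)

/-- The constant `4 * e ^ (4 + γ n)`. -/
def Gam (g : ℝ → ℝ) (n : ℕ) : ℝ := 4 * Real.exp (4 + gam g n)

end ControlledDeriv

end

open Set

namespace ControlledDeriv

/-! Write `N = n + 1`. The core is Bang's estimate `IsDerivChain.bang`: if the derivatives of order
`j ≤ n` are tiny compared with `M j` at points `x n ≤ ⋯ ≤ x 0 ≤ y`, then `f` needs a time of at
least the sum of the `1 / (e * μ l)`, `p < l ≤ n + 1`, to reach size `e ^ (-p) * M₀` at `y`. The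
choice of `N` makes this sum at least `1`, so inside `[0, 1]` there is not enough time.

Let `y` maximise `|f|`. Half of `E` lies on one side of `y`, by reflection the left one. Interpolate
`f` at `n + 1` separated points of that half by a polynomial `P`. By Rolle, `f - P` has zeros of its
derivatives at decreasing points `ξ j`. If all `P^(j) (ξ j)` were tiny, so would be `f^(j) (ξ j)`,
contradicting Bang; hence for some `j` the polynomial has a large derivative. But the derivatives of
`P` are bounded by `sup_E |f|`, so `M j * |I| ^ j` is bounded by `sup_E |f|`.

This controls `f` on `I`. If `|I| * μ (n + 1) ≤ n + 1`, the interpolation error is small, as `M (n +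
1) ≤ M j * μ (n + 1) ^ (n + 1 - j)`. Otherwise even `M₀` is bounded, since the growth bound `γ` on
the interpolating function makes `M₀ * μ (n + 1) ^ j` at most `e ^ (γ * (n + 1)) * M j`. -/

theorem FullAdmissibleWeight.M_zero (W : FullAdmissibleWeight) : W.M 0 = W.M₀ := by
  simp [FullAdmissibleWeight.M]

theorem FullAdmissibleWeight.M_succ (W : FullAdmissibleWeight) (j : ℕ) :
    W.M (j + 1) = W.M j * W.μ (j + 1) := by
  simp only [FullAdmissibleWeight.M]
  rw [Finset.prod_Icc_succ_top (by omega)]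
  ring

theorem FullAdmissibleWeight.M_pos (W : FullAdmissibleWeight) (j : ℕ) : 0 < W.M j := by
  refine mul_pos W.M₀_pos (Finset.prod_pos fun i hi => W.μ_pos i (Finset.mem_Icc.1 hi).1)

theorem FullAdmissibleWeight.μ_le (W : FullAdmissibleWeight) {i j : ℕ} (hi : 1 ≤ i)
    (hij : i ≤ j) : W.μ i ≤ W.μ j := by
  induction j, hij using Nat.le_induction with
  | base => exact le_rfl
  | succ j hj ih => exact ih.trans (W.μ_mono j (hi.trans hj))

/-! ### Chains of successive derivatives. -/

/-- The function `D j` is the derivative of order `j` of `D 0` on `s`, for `j ≤ n`. -/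
def IsDerivChain (D : ℕ → ℝ → ℝ) (n : ℕ) (s : Set ℝ) : Prop :=
  ∀ j < n, ∀ x ∈ s, HasDerivWithinAt (D j) (D (j + 1) x) s x

theorem IsDerivChain.mono {D : ℕ → ℝ → ℝ} {n m : ℕ} {s t : Set ℝ} (h : IsDerivChain D n s)
    (hm : m ≤ n) (hst : t ⊆ s) : IsDerivChain D m t :=
  fun j hj x hx => (h j (hj.trans_le hm) x (hst hx)).mono hst

theorem IsDerivChain.tail {D : ℕ → ℝ → ℝ} {n : ℕ} {s : Set ℝ} (h : IsDerivChain D (n + 1) s) :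
    IsDerivChain (fun j => D (j + 1)) n s :=
  fun j hj x hx => h (j + 1) (by omega) x hx

theorem IsDerivChain.sub {D F : ℕ → ℝ → ℝ} {n : ℕ} {s : Set ℝ} (h : IsDerivChain D n s)
    (h' : IsDerivChain F n s) : IsDerivChain (fun j x => D j x - F j x) n s :=
  fun j hj x hx => (h j hj x hx).sub (h' j hj x hx)

theorem isDerivChain_polynomial (P : Polynomial ℝ) (n : ℕ) (s : Set ℝ) :
    IsDerivChain (fun j x => (Polynomial.derivative^[j] P).eval x) n s := by
  intro j _ x _
  simp only [Function.iterate_succ_apply']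
  exact (Polynomial.hasDerivAt _ x).hasDerivWithinAt

/-- The Bang argument runs from left to right; reflection handles sets to the right of the point
where the function is large. The signs disappear in absolute values. -/
theorem IsDerivChain.reflect {D : ℕ → ℝ → ℝ} {n : ℕ} (h : IsDerivChain D n (Icc 0 1)) :
    IsDerivChain (fun j x => (-1) ^ j * D j (1 - x)) n (Icc 0 1) := by
  intro j hj x hx
  have h1 : (1 - x) ∈ Icc (0 : ℝ) 1 := ⟨by linarith [hx.2], by linarith [hx.1]⟩
  have h2 : HasDerivWithinAt (fun x : ℝ => 1 - x) (-1) (Icc 0 1) x := by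
    simpa using (hasDerivWithinAt_id x (Icc (0 : ℝ) 1)).const_sub 1
  have h3 := (h j hj (1 - x) h1).comp x h2
    (fun y hy => ⟨by linarith [hy.2], by linarith [hy.1]⟩)
  have h4 := h3.const_mul ((-1) ^ j)
  rwa [show (-1) ^ j * (D (j + 1) (1 - x) * -1) = (-1) ^ (j + 1) * D (j + 1) (1 - x) by
    rw [pow_succ]; ring] at h4

/-! ### Bang's estimate. -/

/-- Growth of the derivatives of lower order, measured on the scale `e ^ j * M j`. -/
theorem IsDerivChain.propagate {W : FullAdmissibleWeight} {D : ℕ → ℝ → ℝ} {i : ℕ}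
    {x z : ℝ} (hD : IsDerivChain D i (Icc x z)) (hi : 1 ≤ i)
    (hM : ∀ y ∈ Icc x z, |D i y| ≤ W.M i) {A : ℝ} (hA : Real.exp (-i) ≤ A) (k : ℕ)
    (hx : ∀ j, k ≤ j → j < i → |D j x| ≤ A * (Real.exp j * W.M j)) :
    ∀ d j, j + d = i → k ≤ j → ∀ y ∈ Icc x z,
      |D j y| ≤ A * (Real.exp j * W.M j) * Real.exp (Real.exp 1 * W.μ i * (y - x)) := by
  have hA0 : 0 < A := (Real.exp_pos _).trans_le hA
  have hμ := W.μ_pos i hi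
  intro d
  induction d with
  | zero =>
    intro j hj hk y hy
    obtain rfl : j = i := hj
    refine (hM y hy).trans ?_
    -- At the top order the a priori bound `M i` suffices, because `e ^ (-i) ≤ A`.
    have h1 : 1 ≤ A * Real.exp j := by
      calc (1 : ℝ) = Real.exp (-(j : ℝ)) * Real.exp j := by rw [← Real.exp_add]; simp
        _ ≤ _ := by gcongr
    have h2 : 1 ≤ Real.exp (Real.exp 1 * W.μ j * (y - x)) := by
      apply Real.one_le_exp
      have := hy.1
      exact mul_nonneg (mul_nonneg (Real.exp_pos _).le hμ.le) (by linarith)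
    have := W.M_pos j
    calc W.M j = 1 * W.M j * 1 := by ring
      _ ≤ (A * Real.exp j) * W.M j * Real.exp (Real.exp 1 * W.μ j * (y - x)) := by gcongr
      _ = _ := by ring
  | succ d ih =>
    intro j hj hk
    have hji : j < i := by omega
    have hMj := W.M_pos j
    have ih' := ih (j + 1) (by omega) (by omega)
    set c := A * (Real.exp j * W.M j) with hc
    have hc0 : 0 < c := by positivity
    -- Passing from order `j` to `j + 1` costs a factor `e * μ (j + 1) ≤ e * μ i`, which is what
    -- differentiating the exponential majorant yields.
    have key := image_norm_le_of_norm_deriv_right_le_deriv_boundary (a := x) (b := z)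
      (f := D j) (f' := D (j + 1))
      (B := fun y => c * Real.exp (Real.exp 1 * W.μ i * (y - x)))
      (B' := fun y => c * (Real.exp (Real.exp 1 * W.μ i * (y - x)) * (Real.exp 1 * W.μ i)))
      (fun y hy => (hD j hji y hy).continuousWithinAt)
      (fun y hy => (hD j hji y (Ico_subset_Icc_self hy)).mono_of_mem_nhdsWithin
        (Icc_mem_nhdsGE_of_mem hy))
      (by simpa using hx j hk hji)
      (fun y => by
        have : HasDerivAt (fun y : ℝ => Real.exp 1 * W.μ i * (y - x)) (Real.exp 1 * W.μ i) y := by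
          simpa using ((hasDerivAt_id y).sub_const x).const_mul (Real.exp 1 * W.μ i)
        exact this.exp.const_mul c)
      (fun y hy => by
        refine (ih' y (Ico_subset_Icc_self hy)).trans ?_
        have h1 : W.μ (j + 1) ≤ W.μ i := W.μ_le (by omega) (by omega)
        have h2 : Real.exp ((j + 1 : ℕ) : ℝ) = Real.exp j * Real.exp 1 := by
          rw [← Real.exp_add]; simp
        rw [W.M_succ, h2]
        calc _ = c * (Real.exp (Real.exp 1 * W.μ i * (y - x)) * (Real.exp 1 * W.μ (j + 1))) := by
              rw [hc]; ring
          _ ≤ _ := by gcongr)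
    exact fun y hy => key hy

theorem antitone_chain_le {x : ℕ → ℝ} {n : ℕ} (hx : ∀ j < n, x (j + 1) ≤ x j) {k : ℕ}
    (hk : k ≤ n) : x n ≤ x k := by
  induction hk using Nat.decreasingInduction with
  | self => exact le_rfl
  | of_succ k hk ih => exact ih.trans (hx k hk)

/-- To the right of `x k` the orders `≥ k` are under control: those `> k` by the previous stage, and
order `k` by its smallness at `x k`. Each new point thus admits one more order to the same
exponential bound, counted from the starting time `c`. -/
theorem IsDerivChain.propagate_chain {W : FullAdmissibleWeight} {D : ℕ → ℝ → ℝ} {n : ℕ} {y : ℝ}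
    {x : ℕ → ℝ} (hD : IsDerivChain D (n + 1) (Icc (x n) y))
    (hM : ∀ j ≤ n + 1, ∀ z ∈ Icc (x n) y, |D j z| ≤ W.M j)
    (hx : ∀ j < n, x (j + 1) ≤ x j)
    (hsmall : ∀ j ≤ n, |D j (x j)| ≤ Real.exp (j - (n + 1 : ℕ)) * W.M j)
    {i : ℕ} (hi : 1 ≤ i) (hin : i ≤ n + 1) {c : ℝ}
    (hc : ∀ k ≤ n, x k < c → c ≤ y → ∀ j, k ≤ j → j < i →
      |D j c| ≤ Real.exp (-i) * (Real.exp j * W.M j)) :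
    ∀ m k, k + m = n → ∀ z ∈ Icc (x k) y, c ≤ z → ∀ j, k ≤ j → j ≤ i →
      |D j z| ≤ Real.exp (-i) * Real.exp (Real.exp 1 * W.μ i * (z - c)) *
        (Real.exp j * W.M j) := by
  have hμ := W.μ_pos i hi
  have step : ∀ k ≤ n, (c ≤ x k → ∀ z ∈ Icc (x k) y, c ≤ z → ∀ j, k + 1 ≤ j → j ≤ i → k + 1 ≤ n →
      |D j (x k)| ≤ Real.exp (-i) * Real.exp (Real.exp 1 * W.μ i * (x k - c)) *
        (Real.exp j * W.M j)) → ∀ z ∈ Icc (x k) y, c ≤ z → ∀ j, k ≤ j → j ≤ i →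
      |D j z| ≤ Real.exp (-i) * Real.exp (Real.exp 1 * W.μ i * (z - c)) *
        (Real.exp j * W.M j) := by
    intro k hk ih z hz hcz j hkj hji
    have hxk := antitone_chain_le hx hk
    -- Propagation starts at the later of `c` and `x k`; when `x k < c`, the initial values are
    -- supplied by `hc`.
    rcases le_or_gt c (x k) with hck | hck
    · have hsub : Icc (x k) z ⊆ Icc (x n) y := Icc_subset_Icc hxk hz.2
      have h1 : 1 ≤ Real.exp (Real.exp 1 * W.μ i * (x k - c)) :=
        Real.one_le_exp (mul_nonneg (by positivity) (by linarith))
      have := (hD.mono hin hsub).propagate (W := W) hi (fun w hw => hM i hin w (hsub hw))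
        (A := Real.exp (-i) * Real.exp (Real.exp 1 * W.μ i * (x k - c)))
        (le_mul_of_one_le_right (Real.exp_pos _).le h1) k
        (fun l hkl hli => by
          rcases hkl.eq_or_lt with rfl | hkl
          · refine (hsmall k hk).trans ?_
            have := W.M_pos k
            rw [← mul_assoc]
            gcongr
            rw [← Real.exp_add, ← Real.exp_add]
            gcongr
            have h2 : (i : ℝ) ≤ (n + 1 : ℕ) := by exact_mod_cast hin
            have h3 : 0 ≤ Real.exp 1 * W.μ i * (x k - c) :=
              mul_nonneg (by positivity) (by linarith)
            linarith
          · exact ih hck z hz hcz l hkl hli.le (by omega))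
        (i - j) j (by omega) hkj z ⟨hz.1, le_rfl⟩
      refine this.trans (le_of_eq ?_)
      rw [show Real.exp 1 * W.μ i * (z - c) = Real.exp 1 * W.μ i * (x k - c) +
        Real.exp 1 * W.μ i * (z - x k) by ring, Real.exp_add]
      ring
    · have hsub : Icc c z ⊆ Icc (x n) y := Icc_subset_Icc (by linarith) hz.2
      have := (hD.mono hin hsub).propagate (W := W) hi (fun w hw => hM i hin w (hsub hw))
        le_rfl k (hc k hk hck (hcz.trans hz.2)) (i - j) j (by omega) hkj z ⟨hcz, le_rfl⟩
      refine this.trans (le_of_eq (by ring))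
  intro m
  induction m with
  | zero =>
    intro k hk
    refine step k (by omega) fun _ _ _ _ j _ _ h => ?_
    omega
  | succ m ih =>
    intro k hk
    refine step k (by omega) fun hck z hz _ j hkj hji h => ?_
    exact ih (k + 1) (by omega) (x k) ⟨hx k (by omega), hz.1.trans hz.2⟩ hck j hkj hji

/-- Bang's estimate: a function whose derivatives of order `j ≤ n` are small at points
`x n ≤ ⋯ ≤ x 0` needs some time to become large. -/
theorem IsDerivChain.bang {W : FullAdmissibleWeight} {D : ℕ → ℝ → ℝ} {n : ℕ} {y : ℝ}
    {x : ℕ → ℝ} (hD : IsDerivChain D (n + 1) (Icc (x n) y))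
    (hM : ∀ j ≤ n + 1, ∀ z ∈ Icc (x n) y, |D j z| ≤ W.M j)
    (hx : ∀ j < n, x (j + 1) ≤ x j) (hxy : x 0 ≤ y)
    (hsmall : ∀ j ≤ n, |D j (x j)| ≤ Real.exp (j - (n + 1 : ℕ)) * W.M j)
    {p : ℕ} (hp : p ≤ n)
    (hlt : y - x n < ∑ l ∈ Finset.Icc (p + 1) (n + 1), 1 / (Real.exp 1 * W.μ l)) :
    |D 0 y| < Real.exp (-p) * W.M₀ := by
  set S : ℕ → ℝ := fun i => ∑ l ∈ Finset.Icc (i + 1) (n + 1), 1 / (Real.exp 1 * W.μ l) with hS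
  have hSs : ∀ i < n + 1, S i = S (i + 1) + 1 / (Real.exp 1 * W.μ (i + 1)) := by
    intro i hi
    simp only [hS]
    rw [← Finset.sum_Ioc_add_eq_sum_Icc (by omega),
      show Finset.Ioc (i + 1) (n + 1) = Finset.Icc (i + 1 + 1) (n + 1) by ext; simp]
  have hSn : S (n + 1) = 0 := by simp [hS]
  -- At time `x n + S i` the bound restarts with factor `e ^ (-i)`: under rate `e * μ (i + 1)`, the
  -- time `1 / (e * μ (i + 1))` between two restarts costs exactly one factor `e`. The order `i + 1`
  -- is dropped, so the slower rate `e * μ i` applies next.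
  have claim : ∀ d i, i + d = n + 1 → 1 ≤ i → ∀ k ≤ n, ∀ z ∈ Icc (x k) y, x n + S i ≤ z →
      ∀ j, k ≤ j → j ≤ i → |D j z| ≤ Real.exp (-i) *
        Real.exp (Real.exp 1 * W.μ i * (z - (x n + S i))) * (Real.exp j * W.M j) := by
    intro d
    induction d with
    | zero =>
      intro i hi h1 k hk
      obtain rfl : i = n + 1 := by omega
      refine hD.propagate_chain hM hx hsmall h1 le_rfl (fun l hl h => ?_) (n - k) k (by omega)
      have := antitone_chain_le hx hl
      rw [hSn] at h
      linarith
    | succ d ih =>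
      intro i hi h1 k hk
      refine hD.propagate_chain hM hx hsmall h1 (by omega) (fun l hl h h' j hlj hji => ?_)
        (n - k) k (by omega)
      have hμ := W.μ_pos (i + 1) (by omega)
      have h2 := hSs i (by omega)
      have h3 : 0 ≤ 1 / (Real.exp 1 * W.μ (i + 1)) := by positivity
      refine (ih (i + 1) (by omega) (by omega) l hl _ ⟨h.le, h'⟩ (by linarith) j hlj
        (by omega)).trans (le_of_eq ?_)
      rw [← Real.exp_add, h2]
      congr 2
      push_cast
      field_simp
      ring
  -- Either `y` lies in the stage between `x n + S (i + 1)` and `x n + S i`, or it comes earlier and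
  -- a larger `i` gives a better bound.
  have main : ∀ d i, i + d = n → y - x n < S i → |D 0 y| < Real.exp (-i) * W.M₀ := by
    have step : ∀ i ≤ n, y - x n < S i → x n + S (i + 1) ≤ y →
        |D 0 y| < Real.exp (-i) * W.M₀ := by
      intro i hi h1 h2
      have hμ := W.μ_pos (i + 1) (by omega)
      refine (claim (n - i) (i + 1) (by omega) (by omega) 0 (by omega) y ⟨hxy, le_rfl⟩ h2 0 le_rfl
        (by omega)).trans_lt ?_
      have := W.M₀_pos
      rw [W.M_zero, ← Real.exp_add]
      simp only [Nat.cast_zero, Real.exp_zero, one_mul]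
      gcongr
      rw [hSs i (by omega)] at h1
      have h3 : y - (x n + S (i + 1)) < 1 / (Real.exp 1 * W.μ (i + 1)) := by linarith
      rw [lt_div_iff₀ (by positivity)] at h3
      push_cast
      linarith
    intro d
    induction d with
    | zero =>
      rintro i hi h1
      refine step i (by omega) h1 ?_
      obtain rfl : i = n := by omega
      rw [hSn]
      linarith [antitone_chain_le hx (Nat.zero_le i)]
    | succ d ih =>
      intro i hi h1
      rcases le_or_gt (x n + S (i + 1)) y with h2 | h2
      · exact step i (by omega) h1 h2
      · refine (ih (i + 1) (by omega) (by linarith)).trans ?_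
        have := W.M₀_pos
        gcongr
        omega
  exact main (n - p) p (by omega) hlt

/-! ### Iterated Rolle theorem. -/

/-- Rolle gives zeros of the next derivative strictly between consecutive zeros; taking the
rightmost zero at each order produces the decreasing chain that `IsDerivChain.bang` requires. -/
theorem IsDerivChain.exists_zeros {a b : ℝ} : ∀ (n : ℕ) {D : ℕ → ℝ → ℝ}
    (_ : IsDerivChain D n (Icc a b)) {t : ℕ → ℝ} (_ : ∀ i < n, t i < t (i + 1))
    (_ : ∀ i ≤ n, t i ∈ Icc a b) (_ : ∀ i ≤ n, D 0 (t i) = 0),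
    ∃ x : ℕ → ℝ, x 0 = t n ∧ (∀ j < n, x (j + 1) ≤ x j) ∧ t 0 ≤ x n ∧
      ∀ j ≤ n, D j (x j) = 0 := by
  intro n
  induction n with
  | zero =>
    intro D hD t ht htm h0
    exact ⟨fun _ => t 0, rfl, by simp, le_rfl, fun j hj => by
      obtain rfl : j = 0 := by omega
      exact h0 0 le_rfl⟩
  | succ n ih =>
    intro D hD t ht htm h0
    have h : ∀ i, ∃ s, i ≤ n → t i < s ∧ s < t (i + 1) ∧ D 1 s = 0 := by
      intro i
      by_cases hi : i ≤ n
      · have hsub : Icc (t i) (t (i + 1)) ⊆ Icc a b :=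
          Icc_subset_Icc (htm i (by omega)).1 (htm (i + 1) (by omega)).2
        obtain ⟨s, hs, hs0⟩ := exists_hasDerivAt_eq_zero (f := D 0) (f' := D 1)
          (ht i (by omega))
          (fun x hx => ((hD 0 (by omega) x (hsub hx)).mono hsub).continuousWithinAt)
          (by rw [h0 i (by omega), h0 (i + 1) (by omega)])
          (fun x hx => ((hD 0 (by omega) x (hsub (Ioo_subset_Icc_self hx))).mono hsub).hasDerivAt
            (Icc_mem_nhds hx.1 hx.2))
        exact ⟨s, fun _ => ⟨hs.1, hs.2, hs0⟩⟩
      · exact ⟨0, fun h => absurd h hi⟩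
    choose s hs using h
    obtain ⟨x, hx0, hx, hxn, hxD⟩ := ih hD.tail (t := s)
      (fun i hi => (hs i (by omega)).2.1.trans (hs (i + 1) (by omega)).1)
      (fun i hi => ⟨(htm i (by omega)).1.trans (hs i hi).1.le,
        (hs i hi).2.1.le.trans (htm (i + 1) (by omega)).2⟩)
      (fun i hi => (hs i hi).2.2)
    refine ⟨fun j => Nat.casesOn j (t (n + 1)) x, rfl, ?_, ?_, ?_⟩
    · rintro (_ | j) hj
      · exact hx0.le.trans (hs n le_rfl).2.1.le
      · exact hx j (by omega)
    · exact (hs 0 (by omega)).1.le.trans hxn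
    · rintro (_ | j) hj
      · exact h0 _ le_rfl
      · exact hxD j (by omega)

/-- The generalized Rolle theorem for a function with a finite set of zeros. -/
theorem IsDerivChain.exists_zero_of_card {a b : ℝ} {n : ℕ} {D : ℕ → ℝ → ℝ}
    (hD : IsDerivChain D n (Icc a b)) {s : Finset ℝ} (hs : s.card = n + 1)
    (hsub : ∀ x ∈ s, x ∈ Icc a b) (h0 : ∀ x ∈ s, D 0 x = 0) :
    ∃ x ∈ Icc a b, D n x = 0 := by
  let t : ℕ → ℝ := fun i => if h : i < n + 1 then s.orderEmbOfFin hs ⟨i, h⟩ else 0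
  have ht : ∀ i ≤ n, t i ∈ s := by
    intro i hi
    simp only [t, show i < n + 1 by omega, dif_pos]
    exact Finset.orderEmbOfFin_mem _ _ _
  obtain ⟨x, hx0, hx, hxn, hxD⟩ := hD.exists_zeros n (t := t)
    (fun i hi => by
      simp only [t, show i < n + 1 by omega, show i + 1 < n + 1 by omega, dif_pos]
      exact (s.orderEmbOfFin hs).strictMono (Fin.mk_lt_mk.2 (Nat.lt_succ_self i)))
    (fun i hi => hsub _ (ht i hi)) (fun i hi => h0 _ (ht i hi))
  refine ⟨x n, ⟨(hsub _ (ht 0 (by omega))).1.trans hxn, ?_⟩, hxD n le_rfl⟩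
  refine (antitone_chain_le hx (Nat.zero_le n)).trans ?_
  rw [hx0]
  exact (hsub _ (ht n le_rfl)).2

/-! ### Separated nodes and polynomial interpolation. -/

-- Greedy choice: take a point almost at the infimum, discard everything up to distance `l` beyond
-- it, and repeat. The strict inequality leaves room for the error `q`.
open MeasureTheory in
theorem exists_separated_points : ∀ (n : ℕ) {A : Set ℝ} {l : ℝ} (_ : 0 ≤ l) (_ : BddBelow A)
    (_ : ENNReal.ofReal (n * l) < volume A),
    ∃ t : ℕ → ℝ, (∀ i ≤ n, t i ∈ A) ∧ ∀ i < n, t i + l ≤ t (i + 1) := by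
  intro n
  induction n with
  | zero =>
    intro A l hl hA hv
    have : A.Nonempty := by
      rw [nonempty_iff_ne_empty]
      rintro rfl
      simp at hv
    obtain ⟨x, hx⟩ := this
    exact ⟨fun _ => x, fun _ _ => hx, by simp⟩
  | succ n ih =>
    intro A l hl hA hv
    have hne : A.Nonempty := by
      rw [nonempty_iff_ne_empty]
      rintro rfl
      simp at hv
    obtain ⟨q, hq0, hq1⟩ : ∃ q : ℝ, 0 < q ∧
        ENNReal.ofReal ((n + 1 : ℕ) * l + q) < volume A := by
      obtain ⟨r, hr1, hr2⟩ := ENNReal.lt_iff_exists_nnreal_btwn.1 hv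
      have h0 : 0 ≤ ((n + 1 : ℕ) : ℝ) * l := by positivity
      rw [← ENNReal.ofReal_coe_nnreal, ENNReal.ofReal_lt_ofReal_iff_of_nonneg h0] at hr1
      refine ⟨r - (n + 1 : ℕ) * l, by linarith, ?_⟩
      rw [add_sub_cancel, ENNReal.ofReal_coe_nnreal]
      exact hr2
    obtain ⟨x, hx, hxq⟩ := exists_lt_of_csInf_lt hne (lt_add_of_pos_right (sInf A) hq0)
    set B := A ∩ Ioi (sInf A + q + l) with hB
    have hcov : A ⊆ Icc (sInf A) (sInf A + q + l) ∪ B := by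
      intro z hz
      rcases le_or_gt z (sInf A + q + l) with h | h
      · exact Or.inl ⟨csInf_le hA hz, h⟩
      · exact Or.inr ⟨hz, h⟩
    have hBv : ENNReal.ofReal (n * l) < volume B := by
      by_contra! hcon
      have h1 := (measure_mono hcov).trans (measure_union_le (μ := volume) _ _)
      rw [Real.volume_Icc] at h1
      have h2 : volume A ≤ ENNReal.ofReal (sInf A + q + l - sInf A) + ENNReal.ofReal (n * l) :=
        h1.trans (by gcongr)
      rw [← ENNReal.ofReal_add (by linarith) (by positivity)] at h2
      refine absurd (h2.trans_lt' hq1) ?_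
      rw [not_lt]
      apply ENNReal.ofReal_le_ofReal
      push_cast
      linarith
    obtain ⟨t, ht, htl⟩ := ih hl (hA.mono inter_subset_left) hBv
    refine ⟨fun i => Nat.casesOn i x t, ?_, ?_⟩
    · rintro (_ | i) hi
      · exact hx
      · exact (ht i (by omega)).1
    · rintro (_ | i) hi
      · have := (ht 0 (by omega)).2
        simp only [mem_Ioi] at this
        change x + l ≤ t 0
        linarith
      · exact htl i (by omega)

theorem add_mul_le_of_separated {t : ℕ → ℝ} {n : ℕ} {l : ℝ} (ht : ∀ i < n, t i + l ≤ t (i + 1)) {i j : ℕ}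
    (hij : i ≤ j) (hj : j ≤ n) : t i + (j - i : ℕ) * l ≤ t j := by
  induction j, hij using Nat.le_induction with
  | base => simp
  | succ j hij ih =>
    have h1 := ih (by omega)
    have h2 := ht j (by omega)
    rw [Nat.succ_sub hij]
    push_cast
    linarith

theorem injOn_of_separated {t : ℕ → ℝ} {n : ℕ} {l : ℝ} (hl : 0 < l)
    (ht : ∀ i < n, t i + l ≤ t (i + 1)) : Set.InjOn t (Finset.range (n + 1)) := by
  have hlt : ∀ i j, i < j → j ≤ n → t i < t j := fun i j hij hj => by
    have := add_mul_le_of_separated ht hij.le hj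
    have h : (1 : ℝ) ≤ (j - i : ℕ) := by exact_mod_cast (show 1 ≤ j - i by omega)
    nlinarith
  intro i hi j hj hij
  simp only [Finset.coe_range, mem_Iio] at hi hj
  rcases lt_trichotomy i j with h | h | h
  · exact absurd hij (hlt i j h (by omega)).ne
  · exact h
  · exact absurd hij (hlt j i h (by omega)).ne'

/-- The `j`-th node is at distance at least `|i - j| * l` from the `i`-th; the nodes on the left
contribute `i!`, those on the right `(n - i)!`. -/
theorem prod_separated_ge {t : ℕ → ℝ} {n : ℕ} {l : ℝ} (hl : 0 ≤ l)
    (ht : ∀ i < n, t i + l ≤ t (i + 1)) {i : ℕ} (hi : i ≤ n) :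
    (i.factorial * (n - i).factorial : ℝ) * l ^ n ≤
      |∏ j ∈ (Finset.range (n + 1)).erase i, (t i - t j)| := by
  have h1 : ∏ j ∈ (Finset.range (n + 1)).erase i, (t i - t j) =
      (∏ j ∈ Finset.range i, (t i - t j)) *
        ∏ j ∈ Finset.range (n - i), (t i - t (i + 1 + j)) := by
    have : (Finset.range (n + 1)).erase i = Finset.range i ∪ Finset.Ico (i + 1) (n + 1) := by
      ext; simp; omega
    rw [this, Finset.prod_union, Finset.prod_Ico_eq_prod_range]
    · congr 2; congr 1; omega
    · rw [Finset.disjoint_left]; intro a; simp; omega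
  have h2 : (i.factorial : ℝ) * l ^ i ≤ |∏ j ∈ Finset.range i, (t i - t j)| := by
    rw [Finset.abs_prod]
    have : (i.factorial : ℝ) * l ^ i = ∏ j ∈ Finset.range i, ((i - j : ℕ) * l) := by
      rw [Finset.prod_mul_distrib, Finset.prod_const, Finset.card_range,
        ← Finset.prod_range_add_one_eq_factorial, ← Finset.prod_range_reflect]
      push_cast
      congr 1
      refine Finset.prod_congr rfl fun j hj => ?_
      have := Finset.mem_range.1 hj
      have h : i - j = i - 1 - j + 1 := by omega
      rw [h]; push_cast; rfl
    rw [this]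
    refine Finset.prod_le_prod (fun j _ => by positivity) fun j hj => ?_
    have := add_mul_le_of_separated ht (Finset.mem_range.1 hj).le hi
    exact (le_abs_self _).trans' (by linarith)
  have h3 : ((n - i).factorial : ℝ) * l ^ (n - i) ≤
      |∏ j ∈ Finset.range (n - i), (t i - t (i + 1 + j))| := by
    rw [Finset.abs_prod]
    have : ((n - i).factorial : ℝ) * l ^ (n - i) =
        ∏ j ∈ Finset.range (n - i), ((j + 1 : ℕ) * l) := by
      rw [Finset.prod_mul_distrib, Finset.prod_const, Finset.card_range,
        ← Finset.prod_range_add_one_eq_factorial]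
      push_cast
      rfl
    rw [this]
    refine Finset.prod_le_prod (fun j _ => by positivity) fun j hj => ?_
    have := Finset.mem_range.1 hj
    have := add_mul_le_of_separated ht (show i ≤ i + 1 + j by omega) (by omega)
    rw [show i + 1 + j - i = j + 1 by omega] at this
    exact (neg_le_abs _).trans' (by linarith)
  rw [h1, abs_mul]
  calc _ = (i.factorial * l ^ i) * ((n - i).factorial * l ^ (n - i)) := by
        rw [show l ^ n = l ^ i * l ^ (n - i) by rw [← pow_add]; congr 1; omega]; ring
    _ ≤ _ := by gcongr

/-- Bounds for the derivatives of an interpolation polynomial with separated nodes. -/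
theorem abs_derivative_interpolate_le {t : ℕ → ℝ} {n : ℕ} {l q d x : ℝ} (hl : 0 < l)
    (ht : ∀ i < n, t i + l ≤ t (i + 1)) (hx : ∀ i ≤ n, |x - t i| ≤ d) {P : Polynomial ℝ}
    (hP : P.degree < (n + 1 : ℕ)) (hq : ∀ i ≤ n, |P.eval (t i)| ≤ q) {j : ℕ} (hj : j ≤ n) :
    |(Polynomial.derivative^[j] P).eval x| ≤
      q * (2 ^ n * d ^ (n - j) / ((n - j).factorial * l ^ n)) := by
  have hd : 0 ≤ d := (abs_nonneg _).trans (hx 0 (by omega))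
  have hq0 : 0 ≤ q := (abs_nonneg _).trans (hq 0 (by omega))
  have hinj := injOn_of_separated hl ht
  rw [Lagrange.eval_iterate_derivative_eq_sum hinj (by simpa using hP) (by simp; omega)]
  rw [abs_mul, Nat.abs_cast]
  -- There are `n.choose j` products of `n - j` factors, each factor at most `d`. The node
  -- denominators turn into binomial coefficients `n.choose i`, whose sum is `2 ^ n`.
  have hterm : ∀ i ∈ Finset.range (n + 1),
      |P.eval (t i) / (∏ m ∈ (Finset.range (n + 1)).erase i, (t i - t m)) *
        ∑ T ∈ ((Finset.range (n + 1)).erase i).powersetCard ((Finset.range (n + 1)).card - (j + 1)),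
          ∏ a ∈ T, (x - t a)| ≤
      (q / (n.factorial * l ^ n) * (n.choose j * d ^ (n - j))) * (n.choose i : ℝ) := by
    intro i hi
    have hin : i ≤ n := by have := Finset.mem_range.1 hi; omega
    have h1 : |∑ T ∈ ((Finset.range (n + 1)).erase i).powersetCard
        ((Finset.range (n + 1)).card - (j + 1)), ∏ a ∈ T, (x - t a)| ≤
        n.choose j * d ^ (n - j) := by
      refine (Finset.abs_sum_le_sum_abs _ _).trans ?_
      refine (Finset.sum_le_card_nsmul _ _ (d ^ (n - j)) fun T hT => ?_).trans ?_
      · rw [Finset.mem_powersetCard] at hT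
        rw [Finset.abs_prod]
        have hc : T.card = n - j := by rw [hT.2]; simp
        rw [← hc, ← Finset.prod_const]
        refine Finset.prod_le_prod (fun _ _ => abs_nonneg _) fun a ha => hx a ?_
        have := Finset.mem_range.1 (Finset.mem_of_mem_erase (hT.1 ha))
        omega
      · rw [Finset.card_powersetCard, Finset.card_erase_of_mem hi, nsmul_eq_mul]
        simp only [Finset.card_range, Nat.add_sub_cancel]
        rw [show n + 1 - (j + 1) = n - j by omega, Nat.choose_symm hj]
    have h2 := prod_separated_ge hl.le ht hin
    have h3 : 0 < (i.factorial * (n - i).factorial : ℝ) * l ^ n := by positivity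
    rw [abs_mul, abs_div]
    calc _ ≤ q / ((i.factorial * (n - i).factorial : ℝ) * l ^ n) *
          (n.choose j * d ^ (n - j)) := by
          gcongr
          exact hq i hin
      _ = _ := by
        rw [Nat.cast_choose ℝ hin]
        field_simp
  calc _ ≤ (j.factorial : ℝ) * ∑ i ∈ Finset.range (n + 1),
        (q / (n.factorial * l ^ n) * (n.choose j * d ^ (n - j))) * (n.choose i : ℝ) := by
        gcongr
        exact (Finset.abs_sum_le_sum_abs _ _).trans (Finset.sum_le_sum hterm)
    _ = _ := by
      rw [← Finset.mul_sum]
      have : ∑ i ∈ Finset.range (n + 1), (n.choose i : ℝ) = 2 ^ n := by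
        exact_mod_cast Nat.sum_range_choose n
      rw [this, Nat.cast_choose ℝ hj]
      field_simp

/-- The error of polynomial interpolation. -/
theorem IsDerivChain.abs_sub_interpolate_le {a b : ℝ} {n : ℕ} {D : ℕ → ℝ → ℝ}
    (hD : IsDerivChain D (n + 1) (Icc a b)) {t : ℕ → ℝ} (hinj : Set.InjOn t (Finset.range (n + 1)))
    (ht : ∀ i ≤ n, t i ∈ Icc a b) {P : Polynomial ℝ} (hP : P.degree < (n + 1 : ℕ))
    (hPt : ∀ i ≤ n, P.eval (t i) = D 0 (t i)) {K : ℝ} (hK : ∀ x ∈ Icc a b, |D (n + 1) x| ≤ K)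
    {x : ℝ} (hx : x ∈ Icc a b) :
    |D 0 x - P.eval x| ≤ K * (b - a) ^ (n + 1) / (n + 1).factorial := by
  have hab : a ≤ b := hx.1.trans hx.2
  have hK0 : 0 ≤ K := (abs_nonneg _).trans (hK x hx)
  set w := Lagrange.nodal (Finset.range (n + 1)) t with hw
  by_cases hxt : ∃ i ≤ n, t i = x
  · obtain ⟨i, hi, rfl⟩ := hxt
    rw [hPt i hi, sub_self, abs_zero]
    have : 0 ≤ b - a := by linarith
    positivity
  push Not at hxt
  have hwx : w.eval x ≠ 0 := by
    rw [hw, Lagrange.eval_nodal, Finset.prod_ne_zero_iff]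
    intro i hi
    exact sub_ne_zero.2 (hxt i (by have := Finset.mem_range.1 hi; omega)).symm
  -- With this `c`, the function `D 0 - Q` vanishes at `x` as well as at the nodes, hence at `n + 2`
  -- points, and Rolle gives `c * (n + 1)! = D (n + 1) y`.
  set c := (D 0 x - P.eval x) / w.eval x with hc
  set Q := P + Polynomial.C c * w with hQ
  have hQd : Polynomial.derivative^[n + 1] Q = Polynomial.C (c * (n + 1).factorial) := by
    rw [hQ, iterate_map_add, Polynomial.iterate_derivative_C_mul]
    rw [Polynomial.iterate_derivative_eq_zero_of_degree_lt hP, zero_add]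
    have := Polynomial.iterate_derivative_prod_X_sub_C (R := ℝ)
      (S := (Finset.range (n + 1)).image t) (k := n + 1)
      (by rw [Finset.card_image_of_injOn hinj]; simp)
    rw [Finset.prod_image hinj, Finset.card_image_of_injOn hinj] at this
    rw [hw, Lagrange.nodal_eq, this]
    simp
  have hcard : (insert x ((Finset.range (n + 1)).image t)).card = n + 1 + 1 := by
    rw [Finset.card_insert_of_notMem, Finset.card_image_of_injOn hinj, Finset.card_range]
    intro h
    obtain ⟨i, hi, hix⟩ := Finset.mem_image.1 h
    exact hxt i (by have := Finset.mem_range.1 hi; omega) hix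
  obtain ⟨y, hy, hy0⟩ := (hD.sub (isDerivChain_polynomial Q (n + 1) _)).exists_zero_of_card hcard
    (by
      intro z hz
      rcases Finset.mem_insert.1 hz with rfl | hz
      · exact hx
      · obtain ⟨i, hi, rfl⟩ := Finset.mem_image.1 hz
        exact ht i (by have := Finset.mem_range.1 hi; omega))
    (by
      intro z hz
      simp only [Function.iterate_zero, id_eq, hQ, Polynomial.eval_add, Polynomial.eval_mul,
        Polynomial.eval_C]
      rcases Finset.mem_insert.1 hz with rfl | hz
      · rw [hc]; field_simp; ring
      · obtain ⟨i, hi, rfl⟩ := Finset.mem_image.1 hz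
        rw [hw, Lagrange.eval_nodal_at_node hi,
          hPt i (by have := Finset.mem_range.1 hi; omega)]
        ring)
  rw [hQd, Polynomial.eval_C] at hy0
  have hcK : |c| ≤ K / (n + 1).factorial := by
    rw [le_div_iff₀ (by positivity)]
    have h1 : c * (n + 1).factorial = D (n + 1) y := by linarith
    have h2 := hK y hy
    rwa [← h1, abs_mul, Nat.abs_cast] at h2
  have hwb : |w.eval x| ≤ (b - a) ^ (n + 1) := by
    rw [hw, Lagrange.eval_nodal, Finset.abs_prod]
    refine (Finset.prod_le_prod (fun _ _ => abs_nonneg _) (g := fun _ => b - a) fun i hi => ?_).trans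
      (by simp)
    have := ht i (by have := Finset.mem_range.1 hi; omega)
    rw [abs_le]
    constructor <;> linarith [this.1, this.2, hx.1, hx.2]
  have h3 : D 0 x - P.eval x = c * w.eval x := by rw [hc]; field_simp
  rw [h3, abs_mul]
  calc _ ≤ K / (n + 1).factorial * (b - a) ^ (n + 1) := by gcongr
    _ = _ := by ring

/-! ### Growth of the weight controlled by its interpolating function. -/

theorem leftDeriv_eq_derivWithin {g : ℝ → ℝ} {u v : ℝ} (hu : 1 ≤ u)
    (hg : ContDiffOn ℝ 1 g (Icc u v)) {s : ℝ} (hs : s ∈ Ioc u v) :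
    leftDeriv g s = derivWithin g (Icc u v) s := by
  have h1 : HasDerivWithinAt g (derivWithin g (Icc u v) s) (Icc u v) s :=
    ((hg.differentiableOn (by norm_num)) s (Ioc_subset_Icc_self hs)).hasDerivWithinAt
  rw [leftDeriv, if_pos (hu.trans_lt hs.1)]
  exact (h1.mono_of_mem_nhdsWithin (Icc_mem_nhdsLE_of_mem hs)).derivWithin
    (uniqueDiffWithinAt_Iic s)

/-- Needed because `gam` is a real `sSup`, which is `0` on unbounded sets. On each half-open piece
the quotient agrees with a continuous function on a compact interval; the point `1` is treated
separately. -/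
theorem IsInterpolation.bddAbove {g : ℝ → ℝ} {μ : ℕ → ℝ} (hg : IsInterpolation g μ) (m : ℝ) :
    BddAbove ((fun s => s * leftDeriv g s / g s) '' Icc (1 : ℝ) m) := by
  obtain ⟨p, hp, hp0, hpt, hpc⟩ := hg.piecewise
  have hp1 : ∀ i, 1 ≤ p i := fun i => hp0 ▸ hp.monotone (Nat.zero_le i)
  obtain ⟨i, hi⟩ := (hpt.eventually (Filter.eventually_ge_atTop m)).exists
  refine BddAbove.mono (image_mono (Icc_subset_Icc_right hi)) ?_
  clear hi
  induction i with
  | zero =>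
    rw [hp0, Icc_self, image_singleton]
    exact bddAbove_singleton
  | succ i ih =>
    have hcont : ContinuousOn (fun s => s * derivWithin g (Icc (p i) (p (i + 1))) s / g s)
        (Icc (p i) (p (i + 1))) := by
      refine ContinuousOn.div (continuousOn_id.mul ?_) ?_ ?_
      · exact (hpc i).continuousOn_derivWithin (uniqueDiffOn_Icc (hp i.lt_succ_self)) (by norm_num)
      · exact (hpc i).continuousOn
      · exact fun s hs => (hg.pos s ((hp1 i).trans hs.1)).ne'
    have h2 : BddAbove ((fun s => s * leftDeriv g s / g s) '' Ioc (p i) (p (i + 1))) := by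
      refine (isCompact_Icc.bddAbove_image hcont).mono ?_
      rintro _ ⟨s, hs, rfl⟩
      refine ⟨s, Ioc_subset_Icc_self hs, ?_⟩
      simp only
      rw [leftDeriv_eq_derivWithin (hp1 i) (hpc i) hs]
    refine (ih.union h2).mono ?_
    rw [← image_union]
    apply image_mono
    intro s hs
    rcases le_or_gt s (p i) with h | h
    · exact Or.inl ⟨hs.1, h⟩
    · exact Or.inr ⟨h, hs.2⟩

/-- The bound says that the logarithmic derivative of `g` is at most `K / s`; the pieces are glued
at the break points. -/
theorem IsInterpolation.antitoneOn {g : ℝ → ℝ} {μ : ℕ → ℝ} (hg : IsInterpolation g μ) {m K : ℝ}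
    (hm : 1 ≤ m) (hK : ∀ s ∈ Icc 1 m, s * leftDeriv g s / g s ≤ K) :
    AntitoneOn (fun s => Real.log (g s) - K * Real.log s) (Icc 1 m) := by
  obtain ⟨p, hp, hp0, hpt, hpc⟩ := hg.piecewise
  have hp1 : ∀ i, 1 ≤ p i := fun i => hp0 ▸ hp.monotone (Nat.zero_le i)
  have main : ∀ i, AntitoneOn (fun s => Real.log (g s) - K * Real.log s)
      (Icc 1 (min (p i) m)) := by
    intro i
    induction i with
    | zero =>
      rw [hp0, min_eq_left hm, Icc_self]
      exact antitoneOn_singleton _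
    | succ i ih =>
      have hii : p i < p (i + 1) := hp i.lt_succ_self
      rcases le_or_gt m (p i) with h | h
      · rw [min_eq_right (h.trans hii.le)]
        rwa [min_eq_right h] at ih
      rw [min_eq_left h.le] at ih
      set v := min (p (i + 1)) m with hv
      have hiv : p i < v := lt_min hii h
      have hsub : Icc (p i) v ⊆ Icc (p i) (p (i + 1)) := Icc_subset_Icc_right (min_le_left _ _)
      have hpos : ∀ s ∈ Icc (p i) v, 0 < g s ∧ 0 < s := fun s hs =>
        ⟨hg.pos s ((hp1 i).trans hs.1), by linarith [hp1 i, hs.1]⟩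
      have hder : ∀ s ∈ interior (Icc (p i) v),
          HasDerivAt (fun s => Real.log (g s) - K * Real.log s)
            (leftDeriv g s / g s - K * s⁻¹) s := by
        intro s hs
        rw [interior_Icc] at hs
        have hs' : s ∈ Icc (p i) v := Ioo_subset_Icc_self hs
        have h1 : HasDerivAt g (leftDeriv g s) s := by
          rw [leftDeriv_eq_derivWithin (hp1 i) (hpc i) ⟨hs.1, (hsub hs').2⟩]
          exact (((hpc i).differentiableOn (by norm_num)) s (hsub hs')).hasDerivWithinAt.hasDerivAt
            (Icc_mem_nhds hs.1 (hs.2.trans_le (min_le_left _ _)))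
        exact (h1.log (hpos s hs').1.ne').sub
          ((Real.hasDerivAt_log (hpos s hs').2.ne').const_mul K)
      have h2 : AntitoneOn (fun s => Real.log (g s) - K * Real.log s) (Icc (p i) v) := by
        refine antitoneOn_of_deriv_nonpos (convex_Icc _ _) ?_ ?_ ?_
        · refine ContinuousOn.sub ?_ ?_
          · exact ((hpc i).continuousOn.mono hsub).log fun s hs => (hpos s hs).1.ne'
          · exact continuousOn_const.mul (continuousOn_id.log fun s hs => (hpos s hs).2.ne')
        · exact fun s hs => (hder s hs).differentiableAt.differentiableWithinAt
        · intro s hs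
          rw [(hder s hs).deriv]
          have hs' := interior_subset hs
          have h3 := hK s ⟨(hp1 i).trans hs'.1, hs'.2.trans (min_le_right _ _)⟩
          have h4 := (hpos s hs').2
          have h5 : leftDeriv g s / g s = (s * leftDeriv g s / g s) * s⁻¹ := by
            field_simp
          rw [h5, ← sub_mul]
          exact mul_nonpos_of_nonpos_of_nonneg (by linarith) (by positivity)
      have h6 := ih.union_right h2 (isGreatest_Icc (hp1 i)) (isLeast_Icc hiv.le)
      rwa [Icc_union_Icc_eq_Icc (hp1 i) hiv.le] at h6
  obtain ⟨i, hi⟩ := (hpt.eventually (Filter.eventually_ge_atTop m)).exists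
  have := main i
  rwa [min_eq_right hi] at this

theorem IsInterpolation.log_sub_log_le {g : ℝ → ℝ} {μ : ℕ → ℝ} (hg : IsInterpolation g μ)
    {m j k : ℕ} (hj : 1 ≤ j) (hjk : j ≤ k) (hk : k ≤ m) :
    Real.log (μ k) - Real.log (μ j) ≤ gam g m * (Real.log k - Real.log j) := by
  have hj' : (1 : ℝ) ≤ j := by exact_mod_cast hj
  have hjk' : (j : ℝ) ≤ k := by exact_mod_cast hjk
  have hk' : (k : ℝ) ≤ m := by exact_mod_cast hk
  have h := hg.antitoneOn (m := m) (K := gam g m) (by linarith)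
    (fun s hs => le_csSup (hg.bddAbove m) ⟨s, hs, rfl⟩)
    ⟨hj', by linarith⟩ ⟨by linarith, hk'⟩ hjk'
  simp only [hg.interp j hj, hg.interp k (hj.trans hjk)] at h
  linarith

/-- Compare `μ 1 ≤ μ 2`, which is possible since `2 ≤ m`. -/
theorem IsInterpolation.gam_nonneg {g : ℝ → ℝ} {W : FullAdmissibleWeight}
    (hg : IsInterpolation g W.μ) {m : ℕ} (hm : 2 ≤ m) : 0 ≤ gam g m := by
  have h := hg.log_sub_log_le (m := m) le_rfl one_le_two hm
  have h1 : Real.log (W.μ 1) ≤ Real.log (W.μ 2) :=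
    Real.log_le_log (W.μ_pos 1 le_rfl) (W.μ_mono 1 le_rfl)
  have h2 : 0 < Real.log 2 := Real.log_pos one_lt_two
  simp only [Nat.cast_ofNat, Nat.cast_one, Real.log_one, sub_zero] at h
  by_contra! hlt
  nlinarith [mul_neg_of_neg_of_pos hlt h2]

theorem prod_Icc_cast_eq_factorial (n : ℕ) : ∏ i ∈ Finset.Icc 1 n, (i : ℝ) = n.factorial := by
  induction n with
  | zero => simp
  | succ n ih =>
    rw [Finset.prod_Icc_succ_top (by omega), ih, Nat.factorial_succ]
    push_cast
    ring

/-- Since `μ N / μ i ≤ (N / i) ^ γ`, the product over `i ≤ N` is at most `(N ^ N / N!) ^ γ ≤ e ^ (γ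
* N)`. Stopping at `j` only omits factors `≥ 1`. -/
theorem IsInterpolation.pow_mul_le_M {g : ℝ → ℝ} {W : FullAdmissibleWeight}
    (hg : IsInterpolation g W.μ) {m N j : ℕ} (hN : 1 ≤ N) (hNm : N ≤ m) (hm : 2 ≤ m)
    (hj : j ≤ N) : W.M₀ * W.μ N ^ j ≤ Real.exp (gam g m * N) * W.M j := by
  have hγ := hg.gam_nonneg hm
  have hμ : ∀ i ∈ Finset.Icc 1 N, 0 < W.μ i := fun i hi => W.μ_pos i (Finset.mem_Icc.1 hi).1
  have hμN := W.μ_pos N hN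
  have hsub : Finset.Icc 1 j ⊆ Finset.Icc 1 N := Finset.Icc_subset_Icc_right hj
  have h1 : ∑ i ∈ Finset.Icc 1 j, (Real.log (W.μ N) - Real.log (W.μ i)) ≤ gam g m * N := by
    calc _ ≤ ∑ i ∈ Finset.Icc 1 N, (Real.log (W.μ N) - Real.log (W.μ i)) := by
          refine Finset.sum_le_sum_of_subset_of_nonneg hsub fun i hi _ => ?_
          have hi' := Finset.mem_Icc.1 hi
          exact sub_nonneg.2 (Real.log_le_log (hμ i hi) (W.μ_le hi'.1 hi'.2))
      _ ≤ ∑ i ∈ Finset.Icc 1 N, gam g m * (Real.log N - Real.log i) := by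
          refine Finset.sum_le_sum fun i hi => ?_
          have hi' := Finset.mem_Icc.1 hi
          exact hg.log_sub_log_le hi'.1 hi'.2 hNm
      _ = gam g m * (N * Real.log N - Real.log N.factorial) := by
          rw [← Finset.mul_sum, Finset.sum_sub_distrib, ← prod_Icc_cast_eq_factorial, Real.log_prod]
          · simp
          · intro i hi
            have := (Finset.mem_Icc.1 hi).1
            exact_mod_cast (by omega : i ≠ 0)
      _ ≤ gam g m * N := by
          gcongr
          have h2 := Real.pow_div_factorial_le_exp (x := (N : ℝ)) (by positivity) N
          have hN0 : (0 : ℝ) < N := by exact_mod_cast hN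
          have h3 := Real.log_le_log (by positivity) h2
          rw [Real.log_exp, Real.log_div (by positivity) (by positivity), Real.log_pow] at h3
          exact h3
  have h4 : W.μ N ^ j ≤ Real.exp (gam g m * N) * ∏ i ∈ Finset.Icc 1 j, W.μ i := by
    have hP : 0 < ∏ i ∈ Finset.Icc 1 j, W.μ i := Finset.prod_pos fun i hi => hμ i (hsub hi)
    rw [← Real.log_le_log_iff (by positivity) (by positivity),
      Real.log_mul (by positivity) hP.ne', Real.log_exp, Real.log_pow,
      Real.log_prod fun i hi => (hμ i (hsub hi)).ne']
    rw [Finset.sum_sub_distrib] at h1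
    simp at h1
    linarith
  rw [FullAdmissibleWeight.M]
  have := W.M₀_pos
  calc _ ≤ W.M₀ * (Real.exp (gam g m * N) * ∏ i ∈ Finset.Icc 1 j, W.μ i) := by gcongr
    _ = _ := by ring

theorem FullAdmissibleWeight.M_le_mul_pow (W : FullAdmissibleWeight) {j N : ℕ} (h : j ≤ N) :
    W.M N ≤ W.M j * W.μ N ^ (N - j) := by
  have main : ∀ d, ∀ i, i = j + d → i ≤ N → W.M i ≤ W.M j * W.μ N ^ d := by
    intro d
    induction d with
    | zero => rintro i rfl _; simp
    | succ d ih =>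
      rintro i rfl hi
      have h1 := ih (j + d) rfl (by omega)
      have h2 : W.μ (j + d + 1) ≤ W.μ N := W.μ_le (by omega) hi
      have h3 := W.M_pos j
      have h4 := W.M_pos (j + d)
      have h5 := W.μ_pos (j + d + 1) (by omega)
      rw [← add_assoc, W.M_succ, pow_succ, ← mul_assoc]
      have h6 : 0 < W.μ N := h5.trans_le h2
      gcongr
  exact main (N - j) N (by omega) le_rfl

/-! ### The Remez inequality for derivative chains. -/

/-- A Remez type inequality, for a set that lies to the left of a point at which the function is
large. -/
theorem IsDerivChain.remez_left {W : FullAdmissibleWeight} {D : ℕ → ℝ → ℝ} {n p : ℕ}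
    (hD : IsDerivChain D (n + 1) (Icc 0 1)) (hM : ∀ j ≤ n + 1, ∀ x ∈ Icc (0 : ℝ) 1, |D j x| ≤ W.M j)
    {y : ℝ} (hy : y ∈ Icc (0 : ℝ) 1) (hyp : Real.exp (-p) * W.M₀ ≤ |D 0 y|) (hp : p ≤ n)
    (hsum : 1 ≤ ∑ l ∈ Finset.Icc (p + 1) (n + 1), 1 / (Real.exp 1 * W.μ l))
    {γ : ℝ} (hγ0 : 0 ≤ γ)
    (hγ : ∀ j ≤ n, W.M₀ * W.μ (n + 1) ^ j ≤ Real.exp (γ * (n + 1 : ℕ)) * W.M j)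
    {u v l r q : ℝ} (hl : 0 < l) (hr : v - u = 2 * (n + 1 : ℕ) * r * l) (hr0 : 0 < r)
    (huv : Icc u v ⊆ Icc 0 1) {A : Set ℝ} (hAuv : A ⊆ Icc u v) (hAy : A ⊆ Ioc 0 y)
    (hA : ENNReal.ofReal (n * l) < MeasureTheory.volume A) (hq : ∀ x ∈ A, |D 0 x| ≤ q)
    {x : ℝ} (hx : x ∈ Icc u v) :
    |D 0 x| ≤ q * (4 * r) ^ n * Real.exp ((4 + γ) * (n + 1 : ℕ)) := by
  obtain ⟨t, htA, htl⟩ := exists_separated_points n hl.le ⟨0, fun z hz => (hAy hz).1.le⟩ hA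
  have htuv : ∀ i ≤ n, t i ∈ Icc u v := fun i hi => hAuv (htA i hi)
  have hinj := injOn_of_separated hl htl
  set P := Lagrange.interpolate (Finset.range (n + 1)) t (fun i => D 0 (t i)) with hPdef
  have hP : P.degree < (n + 1 : ℕ) := by
    have h := Lagrange.degree_interpolate_lt (fun i => D 0 (t i)) hinj
    rwa [Finset.card_range] at h
  have hPt : ∀ i ≤ n, P.eval (t i) = D 0 (t i) := fun i hi =>
    Lagrange.eval_interpolate_at_node _ hinj (Finset.mem_range.2 (by omega))
  have hq0 : 0 ≤ q := (abs_nonneg _).trans (hq _ (htA 0 (by omega)))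
  have hd : 0 < v - u := by rw [hr]; positivity
  have hN0 : (0 : ℝ) < (n + 1 : ℕ) := by positivity
  -- The relation `v - u = 2 * (n + 1) * r * l` turns `2 ^ n * (v - u) ^ n / l ^ n` into `(4 * r) ^
  -- n * (n + 1) ^ n`.
  have hPb : ∀ z ∈ Icc u v, ∀ j ≤ n, |(Polynomial.derivative^[j] P).eval z| * (v - u) ^ j ≤
      q * (4 * r) ^ n * ((n + 1 : ℕ) ^ n / (n - j).factorial) := by
    intro z hz j hj
    have h := abs_derivative_interpolate_le (x := z) (d := v - u) hl htl (fun i hi => by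
      have := htuv i hi
      rw [abs_le]; constructor <;> linarith [this.1, this.2, hz.1, hz.2]) hP
      (fun i hi => (congrArg abs (hPt i hi)).trans_le (hq _ (htA i hi))) hj
    calc _ ≤ q * (2 ^ n * (v - u) ^ (n - j) / ((n - j).factorial * l ^ n)) * (v - u) ^ j := by
          gcongr
      _ = q * (2 ^ n * ((v - u) ^ (n - j) * (v - u) ^ j) / ((n - j).factorial * l ^ n)) := by ring
      _ = q * (2 ^ n * (v - u) ^ n / ((n - j).factorial * l ^ n)) := by
          rw [← pow_add, Nat.sub_add_cancel hj]
      _ = _ := by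
          rw [hr, mul_pow, mul_pow, mul_pow, mul_pow, show (4 : ℝ) = 2 * 2 by norm_num, mul_pow]
          field_simp
  have hexp : ∀ k : ℕ, ((n + 1 : ℕ) : ℝ) ^ k / k.factorial ≤ Real.exp (n + 1 : ℕ) := fun k =>
    Real.pow_div_factorial_le_exp _ hN0.le k
  obtain ⟨ξ, hξ0, hξ, hξn, hξD⟩ := ((hD.mono n.le_succ huv).sub
    (isDerivChain_polynomial P n (Icc u v))).exists_zeros n (t := t)
    (fun i hi => by linarith [htl i hi]) htuv (fun i hi => by simp [hPt i hi])
  have hξmem : ∀ j ≤ n, ξ j ∈ Icc u v := fun j hj =>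
    ⟨(htuv 0 (by omega)).1.trans (hξn.trans (antitone_chain_le hξ hj)), by
      have := antitone_chain_le (n := j) (fun i hi => hξ i (by omega)) (Nat.zero_le j)
      exact this.trans (hξ0.le.trans (htuv n le_rfl).2)⟩
  -- Otherwise Bang's estimate applies to the points `ξ j`. As `A` omits `0`, `ξ n > 0` and so `y -
  -- ξ n < 1`, strictly below the sum in `hsum`.
  obtain ⟨j, hj, hbig⟩ : ∃ j ≤ n, Real.exp (j - (n + 1 : ℕ)) * W.M j <
      |(Polynomial.derivative^[j] P).eval (ξ j)| := by
    by_contra! hcon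
    have h0 : 0 < ξ n := (hAy (htA 0 (by omega))).1.trans_le hξn
    have hsub : Icc (ξ n) y ⊆ Icc 0 1 := Icc_subset_Icc h0.le hy.2
    refine absurd hyp (not_le.2 ((hD.mono le_rfl hsub).bang (W := W)
      (fun j hj z hz => hM j hj z (hsub hz)) hξ (hξ0.le.trans (hAy (htA n le_rfl)).2)
      (fun j hj => ?_) hp (by linarith [hy.2])))
    rw [sub_eq_zero.1 (hξD j hj)]
    exact hcon j hj
  set X := q * (4 * r) ^ n with hX
  have hX0 : 0 ≤ X := by positivity
  have hMj := W.M_pos j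
  have hμ : 0 < W.μ (n + 1) := W.μ_pos _ (by omega)
  have hkey : W.M j * (v - u) ^ j ≤
      Real.exp (n + 1 : ℕ) * (X * ((n + 1 : ℕ) ^ n / (n - j).factorial)) := by
    have h1 := (mul_le_mul_of_nonneg_right hbig.le (by positivity : 0 ≤ (v - u) ^ j)).trans
      (hPb (ξ j) (hξmem j hj) j hj)
    have h2 : Real.exp (n + 1 : ℕ) * Real.exp (j - (n + 1 : ℕ)) = Real.exp j := by
      rw [← Real.exp_add]; congr 1; ring
    have h3 : 1 ≤ Real.exp (j : ℝ) := Real.one_le_exp (by positivity)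
    calc W.M j * (v - u) ^ j ≤ Real.exp j * (W.M j * (v - u) ^ j) :=
          le_mul_of_one_le_left (by positivity) h3
      _ = Real.exp (n + 1 : ℕ) * (Real.exp (j - (n + 1 : ℕ)) * W.M j * (v - u) ^ j) := by
          rw [← h2]; ring
      _ ≤ _ := by gcongr
  -- Short interval: the error of interpolation is small enough. Long interval: the trivial bound
  -- `M₀` is already small enough.
  rcases le_total ((v - u) * W.μ (n + 1)) (n + 1 : ℕ) with hcase | hcase
  · have h1 := (hD.mono le_rfl huv).abs_sub_interpolate_le hinj htuv hP hPt
      (fun z hz => hM (n + 1) le_rfl z (huv hz)) hx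
    have h2 := hPb x hx 0 (by omega)
    simp only [pow_zero, mul_one, Function.iterate_zero, id_eq, Nat.sub_zero] at h2
    have h3 : W.M (n + 1) * (v - u) ^ (n + 1) / (n + 1).factorial ≤
        X * Real.exp (3 * (n + 1 : ℕ)) := by
      calc _ ≤ W.M j * W.μ (n + 1) ^ (n + 1 - j) * (v - u) ^ (n + 1) / (n + 1).factorial := by
            gcongr
            exact W.M_le_mul_pow (by omega)
        _ = (W.M j * (v - u) ^ j) * ((v - u) * W.μ (n + 1)) ^ (n + 1 - j) /
              (n + 1).factorial := by
            rw [mul_pow, show (v - u) ^ (n + 1) = (v - u) ^ j * (v - u) ^ (n + 1 - j) by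
              rw [← pow_add]; congr 1; omega]
            ring
        _ ≤ (Real.exp (n + 1 : ℕ) * (X * ((n + 1 : ℕ) ^ n / (n - j).factorial))) *
              ((n + 1 : ℕ) : ℝ) ^ (n + 1 - j) / (n + 1).factorial := by gcongr
        _ = X * (Real.exp (n + 1 : ℕ) * (((n + 1 : ℕ) : ℝ) ^ (n - j) / (n - j).factorial) *
              (((n + 1 : ℕ) : ℝ) ^ (n + 1) / (n + 1).factorial)) := by
            rw [show n + 1 - j = (n - j) + 1 by omega, pow_succ _ (n - j), pow_succ _ n]
            ring
        _ ≤ X * (Real.exp (n + 1 : ℕ) * Real.exp (n + 1 : ℕ) * Real.exp (n + 1 : ℕ)) := by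
            gcongr
            · exact hexp _
            · exact hexp _
        _ = _ := by
            rw [← Real.exp_add, ← Real.exp_add]
            congr 2
            ring
    have h4 : |D 0 x| ≤ |D 0 x - P.eval x| + |P.eval x| := by
      simpa using abs_add_le (D 0 x - P.eval x) (P.eval x)
    have h5 : Real.exp (n + 1 : ℕ) + Real.exp (3 * (n + 1 : ℕ)) ≤
        Real.exp ((4 + γ) * (n + 1 : ℕ)) := by
      have hN1 : (1 : ℝ) ≤ (n + 1 : ℕ) := by exact_mod_cast Nat.succ_pos n
      have h6 : (2 : ℝ) ≤ Real.exp (n + 1 : ℕ) := by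
        linarith [Real.add_one_le_exp ((n + 1 : ℕ) : ℝ)]
      have h7 : Real.exp (n + 1 : ℕ) ≤ Real.exp (3 * (n + 1 : ℕ)) :=
        Real.exp_le_exp.2 (by linarith)
      calc _ ≤ Real.exp (n + 1 : ℕ) * Real.exp (3 * (n + 1 : ℕ)) := by
            nlinarith [Real.exp_pos (3 * ((n + 1 : ℕ) : ℝ))]
        _ = Real.exp (4 * (n + 1 : ℕ)) := by rw [← Real.exp_add]; congr 1; ring
        _ ≤ _ := by gcongr; linarith
    calc _ ≤ X * Real.exp (3 * (n + 1 : ℕ)) + X * Real.exp (n + 1 : ℕ) := by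
          have := mul_le_mul_of_nonneg_left (hexp n) hX0
          linarith
      _ ≤ _ := by rw [← mul_add, add_comm]; gcongr
  · refine (hM 0 (by omega) x (huv hx)).trans ?_
    rw [W.M_zero]
    have h1 : W.M₀ * ((n + 1 : ℕ) : ℝ) ^ j ≤ Real.exp (γ * (n + 1 : ℕ)) *
        (Real.exp (n + 1 : ℕ) * (X * ((n + 1 : ℕ) ^ n / (n - j).factorial))) := by
      have := W.M₀_pos
      calc _ ≤ W.M₀ * ((v - u) * W.μ (n + 1)) ^ j := by gcongr
        _ = (W.M₀ * W.μ (n + 1) ^ j) * (v - u) ^ j := by rw [mul_pow]; ring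
        _ ≤ (Real.exp (γ * (n + 1 : ℕ)) * W.M j) * (v - u) ^ j :=
            mul_le_mul_of_nonneg_right (hγ j hj) (by positivity)
        _ = Real.exp (γ * (n + 1 : ℕ)) * (W.M j * (v - u) ^ j) := by ring
        _ ≤ _ := by gcongr
    have h2 : W.M₀ ≤ Real.exp (γ * (n + 1 : ℕ)) *
        (Real.exp (n + 1 : ℕ) * (X * (((n + 1 : ℕ) : ℝ) ^ (n - j) / (n - j).factorial))) := by
      refine le_of_mul_le_mul_right (h1.trans (le_of_eq ?_)) (by positivity :
        0 < ((n + 1 : ℕ) : ℝ) ^ j)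
      rw [show ((n + 1 : ℕ) : ℝ) ^ n = ((n + 1 : ℕ) : ℝ) ^ (n - j) * ((n + 1 : ℕ) : ℝ) ^ j by
        rw [← pow_add]; congr 1; omega]
      ring
    calc _ ≤ Real.exp (γ * (n + 1 : ℕ)) * (Real.exp (n + 1 : ℕ) * (X * Real.exp (n + 1 : ℕ))) := by
          refine h2.trans ?_
          gcongr
          exact hexp _
      _ = X * Real.exp ((2 + γ) * (n + 1 : ℕ)) := by
          rw [show (2 + γ) * ((n + 1 : ℕ) : ℝ) = γ * (n + 1 : ℕ) + (n + 1 : ℕ) + (n + 1 : ℕ) by ring,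
            Real.exp_add, Real.exp_add]
          ring
      _ ≤ _ := by gcongr; norm_num

-- The end points `0` and `1` form a null set; leaving them out provides the strict inequality in
-- Bang's estimate, on either side.
open MeasureTheory in
theorem half_lt_volume_inter_or {E : Set ℝ} {l y : ℝ} (hE : E ⊆ Icc 0 1)
    (hv : ENNReal.ofReal (2 * l) < volume E) (hl : 0 ≤ l) :
    ENNReal.ofReal l < volume (E ∩ Ioc 0 y) ∨ ENNReal.ofReal l < volume (E ∩ Ico y 1) := by
  by_contra! hcon
  have hcov : E ⊆ (E ∩ Ioc 0 y ∪ E ∩ Ico y 1) ∪ {0, 1} := by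
    intro z hz
    have h01 := hE hz
    rcases eq_or_lt_of_le h01.1 with h0 | h0
    · exact Or.inr (by simp [← h0])
    rcases eq_or_lt_of_le h01.2 with h1 | h1
    · exact Or.inr (by simp [h1])
    rcases le_total z y with h | h
    · exact Or.inl (Or.inl ⟨hz, h0, h⟩)
    · exact Or.inl (Or.inr ⟨hz, h, h1⟩)
  have h0 : volume ({0, 1} : Set ℝ) = 0 := (Set.toFinite _).measure_zero _
  have := calc volume E ≤ volume ((E ∩ Ioc 0 y ∪ E ∩ Ico y 1) ∪ {0, 1}) := measure_mono hcov
    _ ≤ volume (E ∩ Ioc 0 y ∪ E ∩ Ico y 1) + volume ({0, 1} : Set ℝ) := measure_union_le _ _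
    _ ≤ volume (E ∩ Ioc 0 y) + volume (E ∩ Ico y 1) := by
      rw [h0, add_zero]; exact measure_union_le _ _
    _ ≤ ENNReal.ofReal l + ENNReal.ofReal l := add_le_add hcon.1 hcon.2
    _ = ENNReal.ofReal (2 * l) := by rw [← ENNReal.ofReal_add hl hl, two_mul]
  exact absurd hv this.not_gt

/-- A Remez type inequality for functions with controlled derivatives. -/
theorem IsDerivChain.remez {W : FullAdmissibleWeight} {D : ℕ → ℝ → ℝ} {n p : ℕ}
    (hD : IsDerivChain D (n + 1) (Icc 0 1)) (hM : ∀ j ≤ n + 1, ∀ x ∈ Icc (0 : ℝ) 1, |D j x| ≤ W.M j)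
    {y : ℝ} (hy : y ∈ Icc (0 : ℝ) 1) (hyp : Real.exp (-p) * W.M₀ ≤ |D 0 y|) (hp : p ≤ n)
    (hsum : 1 ≤ ∑ l ∈ Finset.Icc (p + 1) (n + 1), 1 / (Real.exp 1 * W.μ l))
    {γ : ℝ} (hγ0 : 0 ≤ γ)
    (hγ : ∀ j ≤ n, W.M₀ * W.μ (n + 1) ^ j ≤ Real.exp (γ * (n + 1 : ℕ)) * W.M j)
    {u v q : ℝ} (huv : Icc u v ⊆ Icc 0 1) {E : Set ℝ}
    (hE : MeasureTheory.NullMeasurableSet E MeasureTheory.volume) (hEuv : E ⊆ Icc u v)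
    (hE0 : 0 < MeasureTheory.volume E) (hq : ∀ x ∈ E, |D 0 x| ≤ q) {x : ℝ} (hx : x ∈ Icc u v) :
    |D 0 x| ≤ q * (4 * ((v - u) / (MeasureTheory.volume E).toReal)) ^ n *
      Real.exp ((4 + γ) * (n + 1 : ℕ)) := by
  have hEtop : MeasureTheory.volume E ≠ ⊤ :=
    ((MeasureTheory.measure_mono hEuv).trans_lt (by simp)).ne
  set e := (MeasureTheory.volume E).toReal with he
  have he0 : 0 < e := ENNReal.toReal_pos hE0.ne' hEtop
  have heE : MeasureTheory.volume E = ENNReal.ofReal e := (ENNReal.ofReal_toReal hEtop).symm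
  have hd : 0 < v - u := by
    by_contra! hcon
    have h := MeasureTheory.measure_mono (μ := MeasureTheory.volume) hEuv
    rw [Real.volume_Icc, ENNReal.ofReal_of_nonpos hcon] at h
    exact hE0.ne' (nonpos_iff_eq_zero.1 h)
  have hN0 : (0 : ℝ) < (n + 1 : ℕ) := by positivity
  -- With this spacing `n * l` is strictly less than half the measure of `E`, so `n + 1` nodes fit
  -- into one side of `y`.
  set l := e / (2 * (n + 1 : ℕ)) with hl
  have hl0 : 0 < l := by positivity
  have hr : v - u = 2 * (n + 1 : ℕ) * ((v - u) / e) * l := by rw [hl]; field_simp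
  have hr0 : 0 < (v - u) / e := by positivity
  have hv : ENNReal.ofReal (2 * (n * l)) < MeasureTheory.volume E := by
    rw [heE, ENNReal.ofReal_lt_ofReal_iff he0]
    have : e = 2 * ((n + 1 : ℕ) * l) := by rw [hl]; field_simp
    push_cast at this
    linarith
  rcases half_lt_volume_inter_or (y := y) (hEuv.trans huv) hv (by positivity) with h | h
  · exact hD.remez_left hM hy hyp hp hsum hγ0 hγ hl0 hr hr0 huv (inter_subset_left.trans hEuv)
      inter_subset_right h (fun z hz => hq z hz.1) hx
  · have hpre := (MeasureTheory.Measure.measurePreserving_sub_left MeasureTheory.volume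
      (1 : ℝ)).measure_preimage (hE.inter (measurableSet_Ico (a := y) (b := 1)).nullMeasurableSet)
    have habs : ∀ (j : ℕ) (c : ℝ), |(-1) ^ j * c| = |c| := fun j c => by simp [abs_mul]
    have hsub : ∀ z ∈ Icc (1 - v) (1 - u), 1 - z ∈ Icc u v := fun z hz =>
      ⟨by linarith [hz.2], by linarith [hz.1]⟩
    have := hD.reflect.remez_left (W := W) (y := 1 - y) (u := 1 - v) (v := 1 - u) (l := l)
      (r := (v - u) / e) (q := q) (x := 1 - x)
      (fun j hj z hz => by
        rw [habs]
        exact hM j hj _ ⟨by linarith [hz.2], by linarith [hz.1]⟩)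
      ⟨by linarith [hy.2], by linarith [hy.1]⟩ (by rwa [habs, sub_sub_cancel]) hp hsum hγ0 hγ hl0
      (by rw [← hr]; ring) hr0
      (fun z hz => by
        have := huv (hsub z hz)
        exact ⟨by linarith [this.2], by linarith [this.1]⟩)
      (A := (fun z => 1 - z) ⁻¹' (E ∩ Ico y 1))
      (fun z hz => by
        have := hEuv hz.1
        exact ⟨by linarith [this.2], by linarith [this.1]⟩)
      (fun z hz => by
        have := hz.2
        exact ⟨by linarith [this.2], by linarith [this.1]⟩)
      (by rwa [hpre])
      (fun z hz => by
        rw [habs]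
        exact hq _ hz.1)
      ⟨by linarith [hx.2], by linarith [hx.1]⟩
    rwa [habs, sub_sub_cancel] at this

/-! ### From the given data to derivative chains. -/

theorem IsWeightSmooth.isDerivChain {W : FullAdmissibleWeight} {m : ℕ} {K : Set ℝ} {f : ℝ → ℝ}
    (hf : IsWeightSmooth W m K f) : IsDerivChain (fun j => iteratedDeriv j f) m K := by
  obtain ⟨⟨U, hU, hKU, hfU⟩, -⟩ := hf
  intro j hj x hx
  have h1 : DifferentiableWithinAt ℝ (iteratedDerivWithin j f U) U x :=
    hfU.differentiableOn_iteratedDerivWithin (by exact_mod_cast hj) hU.uniqueDiffOn x (hKU hx)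
  have h2 : DifferentiableWithinAt ℝ (iteratedDeriv j f) U x :=
    h1.congr (fun z hz => (iteratedDerivWithin_of_isOpen hU hz).symm)
      (iteratedDerivWithin_of_isOpen hU (hKU hx)).symm
  have h3 := (h2.differentiableAt (hU.mem_nhds (hKU hx))).hasDerivAt
  rw [← iteratedDeriv_succ] at h3
  exact h3.hasDerivWithinAt

theorem IsWeightSmooth.continuousOn {W : FullAdmissibleWeight} {m : ℕ} {K : Set ℝ} {f : ℝ → ℝ}
    (hf : IsWeightSmooth W m K f) {j : ℕ} (hj : j ≤ m) : ContinuousOn (iteratedDeriv j f) K := by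
  obtain ⟨⟨U, hU, hKU, hfU⟩, -⟩ := hf
  refine ContinuousOn.mono ?_ hKU
  exact (hfU.continuousOn_iteratedDerivWithin (by exact_mod_cast hj) hU.uniqueDiffOn).congr
    fun z hz => (iteratedDerivWithin_of_isOpen hU hz).symm

theorem IsWeightSmooth.abs_le {W : FullAdmissibleWeight} {m : ℕ} {K : Set ℝ} {f : ℝ → ℝ}
    (hf : IsWeightSmooth W m K f) (hK : IsCompact K) {j : ℕ} (hj : j ≤ m) {x : ℝ} (hx : x ∈ K) :
    |iteratedDeriv j f x| ≤ W.M j :=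
  (le_csSup (hK.bddAbove_image (hf.continuousOn hj).abs) ⟨x, hx, rfl⟩).trans
    (hf.2 j (by exact_mod_cast hj))

theorem exp_neg_j₀_le {c : ℝ} (hc : 0 < c) : Real.exp (-(j₀ c : ℝ)) ≤ c := by
  have h := Nat.le_ceil (Real.log c⁻¹)
  rw [Real.log_inv] at h
  calc Real.exp (-(j₀ c : ℝ)) ≤ Real.exp (Real.log c) := by
        apply Real.exp_le_exp.2
        rw [j₀, Real.log_inv]
        linarith
    _ = c := Real.exp_log hc

/-- Being one more than the degree, `N` fails the defining inequality, so the sum of the `1 / μ l`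
up to `N` is at least `e`; here `[0, 1]` has diameter `1`. -/
theorem one_le_sum_of_degree {W : FullAdmissibleWeight} {b : ℝ} {N : ℕ}
    (hN : IsAssociatedInteger W (Icc 0 1) b N) :
    1 ≤ ∑ l ∈ Finset.Icc (j₀ (b / (2 * W.M₀)) + 1) N, 1 / (Real.exp 1 * W.μ l) := by
  by_contra! hcon
  have hlt : ∑ l ∈ Finset.Icc (j₀ (b / (2 * W.M₀)) + 1) N,
      1 / (Metric.diam (Icc (0 : ℝ) 1) * W.μ l) < Real.exp 1 := by
    have h : ∑ l ∈ Finset.Icc (j₀ (b / (2 * W.M₀)) + 1) N,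
        1 / (Metric.diam (Icc (0 : ℝ) 1) * W.μ l) = Real.exp 1 *
        ∑ l ∈ Finset.Icc (j₀ (b / (2 * W.M₀)) + 1) N, 1 / (Real.exp 1 * W.μ l) := by
      rw [Finset.mul_sum, Real.diam_Icc zero_le_one]
      refine Finset.sum_congr rfl fun l _ => ?_
      rw [sub_zero, one_mul, one_div, one_div, mul_inv, ← mul_assoc,
        mul_inv_cancel₀ (Real.exp_pos 1).ne', one_mul]
    rw [h]
    exact mul_lt_of_lt_one_right (Real.exp_pos 1) hcon
  have h1 : (N : ℕ∞) ≤ degree (fun j => Metric.diam (Icc (0 : ℝ) 1) * W.μ j)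
      (b / (2 * W.M₀)) :=
    le_iSup₂ (f := fun (n : ℕ) (_ : n ∈ {n : ℕ | ∑ j ∈ Finset.Icc (j₀ (b / (2 * W.M₀)) + 1) n,
      1 / (Metric.diam (Icc (0 : ℝ) 1) * W.μ j) < Real.exp 1}) => (n : ℕ∞)) N hlt
  have h2 : (N : ℕ∞) + 1 ≤ N := by
    conv_rhs => rw [hN]
    gcongr
  exact absurd h2 (not_le.2 (by exact_mod_cast N.lt_succ_self))

theorem subset_Icc_and_volume_eq_of_ordConnected {I : Set ℝ} (hI : I.OrdConnected) (hb : BddBelow I)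
    (ha : BddAbove I) (hne : I.Nonempty) :
    I ⊆ Icc (sInf I) (sSup I) ∧ (MeasureTheory.volume I).toReal = sSup I - sInf I := by
  have hsub : I ⊆ Icc (sInf I) (sSup I) := fun z hz => ⟨csInf_le hb hz, le_csSup ha hz⟩
  refine ⟨hsub, ?_⟩
  have hsub' : Ioo (sInf I) (sSup I) ⊆ I := by
    intro z hz
    obtain ⟨a, haI, haz⟩ := exists_lt_of_csInf_lt hne hz.1
    obtain ⟨c, hcI, hcz⟩ := exists_lt_of_lt_csSup hne hz.2
    exact hI.out haI hcI ⟨haz.le, hcz.le⟩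
  have h1 := MeasureTheory.measure_mono (μ := MeasureTheory.volume) hsub
  have h2 := MeasureTheory.measure_mono (μ := MeasureTheory.volume) hsub'
  rw [Real.volume_Icc] at h1
  rw [Real.volume_Ioo] at h2
  rw [le_antisymm h1 h2, ENNReal.toReal_ofReal]
  obtain ⟨z, hz⟩ := hne
  linarith [(hsub hz).1, (hsub hz).2]

end ControlledDeriv

/-! ### The main theorem. -/

open ControlledDeriv in
theorem mainTheorem6
    (W : ControlledDeriv.FullAdmissibleWeight)
    (g : ℝ → ℝ) (hg : ControlledDeriv.IsInterpolation g W.μ)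
    (b : ℝ) (hdata : ControlledDeriv.IsAdmissibleData W (Set.Icc 0 1) (2 * b))
    (N : ℕ) (hN : ControlledDeriv.IsAssociatedInteger W (Set.Icc 0 1) (2 * b) N)
    (hN2 : 2 ≤ N)
    (f : ℝ → ℝ)
    (hf : ControlledDeriv.IsWeightSmooth W ((2 * (N - 1) : ℕ) : ℕ∞) (Set.Icc 0 1) f)
    (hfb : b ≤ ControlledDeriv.supNorm f (Set.Icc 0 1))
    (I : Set ℝ) (hI : I.OrdConnected) (hI01 : I ⊆ Set.Icc 0 1)
    (E : Set ℝ) (hE : MeasureTheory.NullMeasurableSet E MeasureTheory.volume) (hEI : E ⊆ I)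
    (hE0 : 0 < MeasureTheory.volume E) :
    ControlledDeriv.supNorm f I ≤
      (ControlledDeriv.Gam g (2 * (N - 1)) * (MeasureTheory.volume I).toReal /
          (MeasureTheory.volume E).toReal) ^ (2 * (N - 1)) *
        ControlledDeriv.supNorm f E := by
  obtain ⟨n, rfl⟩ : ∃ n, N = n + 1 := ⟨N - 1, by omega⟩
  simp only [Nat.add_sub_cancel] at hf ⊢
  have hn : 1 ≤ n := by omega
  have hb : 0 < b := by linarith [hdata.2.1]
  have hM0 := W.M₀_pos
  have hsum := one_le_sum_of_degree hN
  -- The data are taken at `2 * b` to cancel the `2` in `IsAssociatedInteger`: `p` is the index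
  -- belonging to `b / M₀`.
  set p := j₀ (2 * b / (2 * W.M₀)) with hpdef
  have hp : p ≤ n := by
    by_contra! h
    rw [Finset.Icc_eq_empty (by omega), Finset.sum_empty] at hsum
    linarith
  have hpb : Real.exp (-p) * W.M₀ ≤ b := by
    have := exp_neg_j₀_le (c := 2 * b / (2 * W.M₀)) (by positivity)
    calc _ ≤ 2 * b / (2 * W.M₀) * W.M₀ := by gcongr
      _ = b := by field_simp
  have hcont : ContinuousOn f (Set.Icc 0 1) := by
    simpa using hf.continuousOn (j := 0) (by omega)
  obtain ⟨y, hy, hymax⟩ := isCompact_Icc.exists_isMaxOn (Set.nonempty_Icc.2 zero_le_one) hcont.abs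
  have hby : b ≤ |f y| := hfb.trans (csSup_le ((Set.nonempty_Icc.2 zero_le_one).image _)
    (by rintro _ ⟨z, hz, rfl⟩; exact hymax hz))
  have hne : E.Nonempty := by
    rw [Set.nonempty_iff_ne_empty]
    rintro rfl
    simp at hE0
  have hbdd : BddAbove ((fun x => |f x|) '' E) :=
    (isCompact_Icc.bddAbove_image hcont.abs).mono (Set.image_mono (hEI.trans hI01))
  have hq : ∀ x ∈ E, |f x| ≤ supNorm f E := fun x hx => le_csSup hbdd ⟨x, hx, rfl⟩
  have hq0 : 0 ≤ supNorm f E := (abs_nonneg _).trans (hq _ hne.some_mem)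
  have hIne := hne.mono hEI
  have hIb : BddBelow I := bddBelow_Icc.mono hI01
  have hIa : BddAbove I := bddAbove_Icc.mono hI01
  obtain ⟨hIuv, hvol⟩ := subset_Icc_and_volume_eq_of_ordConnected hI hIb hIa hIne
  have huv : Set.Icc (sInf I) (sSup I) ⊆ Set.Icc 0 1 :=
    Set.Icc_subset_Icc (le_csInf hIne fun z hz => (hI01 hz).1)
      (csSup_le hIne fun z hz => (hI01 hz).2)
  have hγ0 := hg.gam_nonneg (m := 2 * n) (by omega)
  set γ := gam g (2 * n) with hγ
  have hItop : MeasureTheory.volume I ≠ ⊤ :=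
    ((MeasureTheory.measure_mono hI01).trans_lt (by simp)).ne
  have hr1 : 1 ≤ (MeasureTheory.volume I).toReal / (MeasureTheory.volume E).toReal := by
    have hle := MeasureTheory.measure_mono (μ := MeasureTheory.volume) hEI
    rw [one_le_div (ENNReal.toReal_pos hE0.ne' (ne_top_of_le_ne_top hItop hle))]
    exact ENNReal.toReal_mono hItop hle
  -- Since `n ≥ 1`, both exponents `n` and `n + 1` are at most `2 * n`, and raising them is harmless
  -- because the ratio of the measures is at least `1` and `4 + γ ≥ 0`.
  have hpow : (4 * ((MeasureTheory.volume I).toReal / (MeasureTheory.volume E).toReal)) ^ n *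
      Real.exp ((4 + γ) * (n + 1 : ℕ)) ≤
      (Gam g (2 * n) * (MeasureTheory.volume I).toReal / (MeasureTheory.volume E).toReal) ^
        (2 * n) := by
    calc _ ≤ (4 * ((MeasureTheory.volume I).toReal / (MeasureTheory.volume E).toReal)) ^ (2 * n) *
          Real.exp ((4 + γ) * (2 * n : ℕ)) := by
          gcongr
          · linarith
          · omega
          · omega
      _ = _ := by
          rw [mul_comm (4 + γ), Real.exp_nat_mul, ← mul_pow, Gam, ← hγ]
          congr 1
          ring
  refine csSup_le (hIne.image _) ?_
  rintro _ ⟨x, hx, rfl⟩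
  have key := (hf.isDerivChain.mono (show n + 1 ≤ 2 * n by omega) subset_rfl).remez (W := W)
    (fun j hj z hz => hf.abs_le isCompact_Icc (by omega) hz) hy
    (by simpa using hpb.trans hby) hp hsum hγ0
    (fun j hj => hg.pow_mul_le_M (by omega) (by omega) (by omega) (by omega)) huv hE
    (hEI.trans hIuv) hE0 (q := supNorm f E) (by simpa using hq) (hIuv hx)
  simp only [iteratedDeriv_zero, ← hvol] at key
  calc |f x| ≤ _ := key
    _ = ((4 * ((MeasureTheory.volume I).toReal / (MeasureTheory.volume E).toReal)) ^ n *
      Real.exp ((4 + γ) * (n + 1 : ℕ))) * supNorm f E := by ring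
    _ ≤ _ := by gcongr
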